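/- Let $\mathcal X$ be a Polish space with its Borel $\sigma$-algebra, let $I:\mathcal X\to[0,\infty]$ be a function that is continuous on its domain of finiteness $D=\{I<\infty\}$ (that is, $I|_D$ is continuous), and let $\gamma$ be a measure on $\mathcal X$. For $T\in(0,\infty]$ put $\mu^{T}(dx)=\frac1{Z^{T}}e^{-I(x)/T}\gamma(dx)$ with $Z^T=\int e^{-I/T}d\gamma$ (so $\mu^\infty=\gamma/\gamma(\mathcal X)$, which makes sense only if $0<\gamma(\mathcal X)<\infty$). Assume that $\mu^\varepsilon$ is a well-defined probability measure for every $\varepsilon\in(0,\infty)$ and that $\{\mu^\varepsilon\}$ satisfies the large deviation principle as $\varepsilon\downarrow0$ with scaling $\varepsilon$ and rate function $I$ (in particular, $I$ has compact sublevel sets). Let $A\subset\mathcal X$ be the closure of its interior, and suppose that $A\cap D$ is also the closure of its interior in the subspace $D$ (this is automatic if $D$ is open). Write $I(A)=\inf_{x\in A}I(x)\in[0,\infty]$. Let $K\ge1$, let $\Sigma_K$ be the set of permutations of $\{1,\dots,K\}$, and call $\boldsymbol\alpha=(\alpha_1,\dots,\alpha_K)$ admissible if $1=\alpha_1\ge\alpha_2\ge\cdots\ge\alpha_K\ge0$.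 For $\mathbf x\in\mathcal X^K$ and $\sigma\in\Sigma_K$ write $\mathbf x_\sigma=(x_{\sigma(1)},\dots,x_{\sigma(K)})$, and let $$\rho^\varepsilon(\mathbf x;\boldsymbol\alpha)=\frac{e^{-\frac1\varepsilon\sum_{j}\alpha_jI(x_j)}}{\sum_{\tau\in\Sigma_K}e^{-\frac1\varepsilon\sum_j\alpha_jI(x_{\tau(j)})}},\qquad \hat\theta^\varepsilon(\mathbf x;\boldsymbol\alpha)=\sum_{\sigma\in\Sigma_K}\rho^\varepsilon(\mathbf x_\sigma;\boldsymbol\alpha)\,1_A(x_{\sigma(1)}),$$ with the conventions $e^{-\infty}=0$, $0\cdot\infty=0$ and $0/0=0$. Then for every admissible $\boldsymbol\alpha$ and all $\mathbf X^\varepsilon=(X_1^\varepsilon,\dots,X_K^\varepsilon)$ with independent components $X_j^\varepsilon\sim\mu^{\varepsilon/\alpha_j}$ (where $\varepsilon/0=\infty$), $$\lim_{\varepsilon\to0}-\varepsilon\log E\big(\hat\theta^\varepsilon(\mathbf X^\varepsilon;\boldsymbol\alpha)\big)^2=V(\boldsymbol\alpha)\cdot I(A)\quad\text{in }[0,\infty],$$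 where $$V(\boldsymbol\alpha)=\inf\Big\{2\sum_{j=1}^K\alpha_jI_j-\min_{\sigma\in\Sigma_K}\sum_{j=1}^K\alpha_jI_{\sigma(j)}\;:\;I_1=1,\ I_j\in[0,1]\text{ for }j=2,\dots,K\Big\}.$$ Moreover, over all admissible $\boldsymbol\alpha$, $V(\boldsymbol\alpha)$ attains its maximal value, $2-(1/2)^{K-1}$, at $\boldsymbol\alpha^*=(1,1/2,\dots,1/2^{K-1})$. -/

import Mathlib

open Set Filter Topology MeasureTheory ProbabilityTheory
open scoped NNReal ENNReal

namespace INS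

noncomputable section

/-- `I(A)`, the infimum of `I` over `A` (equal to `∞` if `A` is empty). -/
def infOver {𝒳 : Type*} (I : 𝒳 → ℝ≥0∞) (A : Set 𝒳) : ℝ≥0∞ :=
  ⨅ x ∈ A, I x

/-- `I` is a rate function: every sublevel set at a finite level is compact. -/
def IsRateFunction {𝒳 : Type*} [TopologicalSpace 𝒳] (I : 𝒳 → ℝ≥0∞) : Prop :=
  ∀ M : ℝ≥0, IsCompact {x | I x ≤ M}

/-- The large deviation principle with scaling `ε` (as `ε ↓ 0`) and rate function `I`. -/
structure SatisfiesLDP {𝒳 : Type*} [TopologicalSpace 𝒳] [MeasurableSpace 𝒳]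
    (μ : ℝ → Measure 𝒳) (I : 𝒳 → ℝ≥0∞) : Prop where
  isRateFunction : IsRateFunction I
  lower_bound : ∀ G : Set 𝒳, IsOpen G →
    -(infOver I G : EReal) ≤
      liminf (fun ε : ℝ => (ε : EReal) * ENNReal.log (μ ε G)) (𝓝[>] (0 : ℝ))
  upper_bound : ∀ F : Set 𝒳, IsClosed F →
    limsup (fun ε : ℝ => (ε : EReal) * ENNReal.log (μ ε F)) (𝓝[>] (0 : ℝ)) ≤
      -(infOver I F : EReal)

/-- `e^{-t}` for `t ∈ [0, ∞]`, with `e^{-∞} = 0`. -/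
def expNeg (t : ℝ≥0∞) : ℝ≥0∞ := EReal.exp (-(t : EReal))

/-- The normalizing constant `∫ e^{-I/T} dγ` at temperature `T`. At `T = ∞` the integrand is `1`. -/
def partitionFunction {𝒳 : Type*} [MeasurableSpace 𝒳] (γ : Measure 𝒳) (I : 𝒳 → ℝ≥0∞)
    (T : ℝ≥0∞) : ℝ≥0∞ :=
  ∫⁻ x, expNeg (I x / T) ∂γ

/-- The measure `Z⁻¹ e^{-I/T} dγ` at temperature `T`. It is a probability measure exactly when the
normalizing constant `Z` lies in `(0, ∞)`, and it is the zero measure otherwise. -/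
def gibbs {𝒳 : Type*} [MeasurableSpace 𝒳] (γ : Measure 𝒳) (I : 𝒳 → ℝ≥0∞)
    (T : ℝ≥0∞) : Measure 𝒳 :=
  (partitionFunction γ I T)⁻¹ • γ.withDensity (fun x => expNeg (I x / T))

/-- The probability measures `μ^ε`, `ε ∈ (0, ∞)`, have the form `Z⁻¹ e^{-I/ε} dγ` and satisfy the
large deviation principle with rate function `I`. -/
structure IsGibbsFamily {𝒳 : Type*} [TopologicalSpace 𝒳] [MeasurableSpace 𝒳]
    (μ : ℝ → Measure 𝒳) (γ : Measure 𝒳) (I : 𝒳 → ℝ≥0∞) : Prop where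
  isProbabilityMeasure : ∀ ε : ℝ, 0 < ε → IsProbabilityMeasure (μ ε)
  eq_gibbs : ∀ ε : ℝ, 0 < ε → μ ε = gibbs γ I (ENNReal.ofReal ε)
  ldp : SatisfiesLDP μ I

/-- `1 = α₁ ≥ α₂ ≥ ⋯ ≥ α_K ≥ 0`. -/
def IsParameter {K : ℕ} [NeZero K] (α : Fin K → ℝ≥0) : Prop :=
  α 0 = 1 ∧ Antitone α

/-- The exponential weight `exp(-(1/ε) ∑ⱼ αⱼ I(xⱼ))`. -/
def expWeight {𝒳 : Type*} {K : ℕ} (I : 𝒳 → ℝ≥0∞) (α : Fin K → ℝ≥0) (ε : ℝ)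
    (x : Fin K → 𝒳) : ℝ≥0∞ :=
  expNeg ((∑ j, (α j : ℝ≥0∞) * I (x j)) / ENNReal.ofReal ε)

/-- The weights `ρ^ε(x; α)`. -/
def rho {𝒳 : Type*} {K : ℕ} (I : 𝒳 → ℝ≥0∞) (α : Fin K → ℝ≥0) (ε : ℝ)
    (x : Fin K → 𝒳) : ℝ≥0∞ :=
  expWeight I α ε x / ∑ τ : Equiv.Perm (Fin K), expWeight I α ε (fun j => x (τ j))

/-- The `K`-temperature INS estimator `θ̂^ε(x; α)` for `μ^ε(A)`. -/
def insEstimator {𝒳 : Type*} {K : ℕ} [NeZero K] (I : 𝒳 → ℝ≥0∞) (A : Set 𝒳)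
    (α : Fin K → ℝ≥0) (ε : ℝ) (x : Fin K → 𝒳) : ℝ≥0∞ :=
  ∑ σ : Equiv.Perm (Fin K),
    rho I α ε (fun j => x (σ j)) * A.indicator (fun _ => (1 : ℝ≥0∞)) (x (σ 0))

/-- `2 ∑ⱼ αⱼ Iⱼ - min_σ ∑ⱼ αⱼ I_{σ(j)}`. -/
def decayFunctional {K : ℕ} (α : Fin K → ℝ≥0) (v : Fin K → ℝ) : ℝ :=
  2 * ∑ j, (α j : ℝ) * v j -
    Finset.univ.inf' Finset.univ_nonempty
      (fun σ : Equiv.Perm (Fin K) => ∑ j, (α j : ℝ) * v (σ j))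

/-- `V(α)`: the infimum of the decay functional over `I₁ = 1`, `Iⱼ ∈ [0, 1]` for `j ≥ 2`. -/
def V {K : ℕ} [NeZero K] (α : Fin K → ℝ≥0) : ℝ :=
  sInf (decayFunctional α '' {v | v 0 = 1 ∧ ∀ j, j ≠ 0 → v j ∈ Icc (0 : ℝ) 1})

/-- `α* = (1, 1/2, …, 1/2^{K-1})`. -/
def alphaStar (K : ℕ) : Fin K → ℝ≥0 := fun j => (1 / 2) ^ (j : ℕ)

end

end INS

namespace INS

/-! Write w(x) for the exponential weight at x and S(x) for its sum over all rearrangements. The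
product law has density proportional to w with respect to the product of copies of γ.

Upper bound. Positive homogeneity of the decay functional and the rearrangement inequality give, for
every a ∈ [0,∞]^K, a permutation τ with V(α)a₁ + ∑ αⱼa_{τ(j)} ≤ 2∑ αⱼaⱼ
(`exists_perm_V_mul_add_le`). Taking for a the levels of a rearrangement of x whose first point lies
in A yields θ̂² · w ≤ (K!)² exp(-V(α)I(A)/ε) pointwise (`insEstimator_sq_mul_le`). Integrating 1/w
against the law would give γ(𝒳), which may be infinite. Since θ̂ ≤ 1, the bound may first be raised
to a power κ < 1; the remaining factor e^{-(1-κ)αⱼI/ε} is γ-integrable for small ε, and letting κ →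
1 costs nothing in the rate.

Lower bound. `I` need not take values between 0 and I(A), so a general minimizer in V(α) may not be
realizable. The decay functional is linear on vectors with a common order, so by the layer cake
formula some zero-one vector is already optimal (`exists_zeroOne_le_V`). Levels 0 and I(A) are
always approximable on sets of positive γ-measure, by the large deviation lower bound and the
regularity of A in D (`measure_inter_le_ne_zero`). A box of points near these levels, placed in the
order that minimizes the exponent, gives the matching bound.

Optimization. For α*, cyclic rotation as the competing permutation bounds the functional below by 2
- 2^{-(K-1)} on all constrained vectors. For general α, K zero-one test vectors give inequalities
that cannot all fail. -/

/-- The zero-one vector of a finite set of indices. -/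
noncomputable def zeroOne {K : ℕ} (S : Finset (Fin K)) : Fin K → ℝ := fun j => if j ∈ S then 1 else 0

/-! ### The decay functional, its zero-one minimizers and the weighted rearrangement inequality -/

section Combinatorics

variable {K : ℕ} {α : Fin K → ℝ≥0}

/-- Rearrangement inequality: pairing the decreasing α with increasing values minimizes the sum,
which makes the minimum over permutations explicit and linear on vectors sorted by the same τ. -/
theorem sum_sorted_le (hα : Antitone α) {v : Fin K → ℝ} {τ : Equiv.Perm (Fin K)}
    (hτ : Monotone (v ∘ τ)) (σ : Equiv.Perm (Fin K)) :
    ∑ j, (α j : ℝ) * v (τ j) ≤ ∑ j, (α j : ℝ) * v (σ j) := by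
  have h : Antivary (fun j => (α j : ℝ)) (v ∘ τ) := by
    have h1 : Antitone (fun j => (α j : ℝ)) := fun i j hij => NNReal.coe_le_coe.2 (hα hij)
    exact h1.antivary hτ
  have h2 := h.sum_mul_le_sum_mul_comp_perm (σ := σ.trans τ.symm)
  simpa using h2

theorem decayFunctional_eq_of_monotone (hα : Antitone α) {v : Fin K → ℝ} {τ : Equiv.Perm (Fin K)}
    (hτ : Monotone (v ∘ τ)) :
    decayFunctional α v = 2 * ∑ j, (α j : ℝ) * v j - ∑ j, (α j : ℝ) * v (τ j) := by
  unfold decayFunctional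
  congr 1
  refine le_antisymm (Finset.inf'_le _ (Finset.mem_univ τ)) ?_
  exact (Finset.le_inf'_iff _ _).2 fun σ _ => sum_sorted_le hα hτ σ

theorem exists_decayFunctional_eq (α : Fin K → ℝ≥0) (v : Fin K → ℝ) :
    ∃ τ : Equiv.Perm (Fin K),
      decayFunctional α v = 2 * ∑ j, (α j : ℝ) * v j - ∑ j, (α j : ℝ) * v (τ j) ∧
      ∀ σ : Equiv.Perm (Fin K), ∑ j, (α j : ℝ) * v (τ j) ≤ ∑ j, (α j : ℝ) * v (σ j) := by
  obtain ⟨τ, -, hτ⟩ := Finset.exists_mem_eq_inf' (s := Finset.univ) Finset.univ_nonempty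
    (fun σ : Equiv.Perm (Fin K) => ∑ j, (α j : ℝ) * v (σ j))
  refine ⟨τ, by unfold decayFunctional; rw [hτ], fun σ => ?_⟩
  rw [← hτ]
  exact Finset.inf'_le _ (Finset.mem_univ σ)

theorem le_decayFunctional (α : Fin K → ℝ≥0) (v : Fin K → ℝ) (σ : Equiv.Perm (Fin K)) :
    2 * ∑ j, (α j : ℝ) * v j - ∑ j, (α j : ℝ) * v (σ j) ≤ decayFunctional α v := by
  unfold decayFunctional
  have := Finset.inf'_le (s := Finset.univ)
    (fun σ : Equiv.Perm (Fin K) => ∑ j, (α j : ℝ) * v (σ j)) (Finset.mem_univ σ)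
  linarith

theorem sum_le_decayFunctional (α : Fin K → ℝ≥0) (v : Fin K → ℝ) :
    ∑ j, (α j : ℝ) * v j ≤ decayFunctional α v := by
  have := le_decayFunctional α v 1
  simp only [Equiv.Perm.coe_one, id_eq] at this
  linarith

theorem integral_Ioc_ite_le {c : ℝ} (hc : c ∈ Icc (0 : ℝ) 1) :
    Integrable (fun t : ℝ => if t ≤ c then (1 : ℝ) else 0) (volume.restrict (Ioc 0 1)) ∧
    ∫ t in Ioc (0 : ℝ) 1, (if t ≤ c then (1 : ℝ) else 0) = c := by
  have h : (fun t : ℝ => if t ≤ c then (1 : ℝ) else 0) = (Iic c).indicator (fun _ => (1 : ℝ)) := by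
    ext t; simp [Set.indicator]
  rw [h]
  refine ⟨(integrable_const _).indicator measurableSet_Iic, ?_⟩
  rw [integral_indicator measurableSet_Iic, Measure.restrict_restrict measurableSet_Iic]
  have : Iic c ∩ Ioc (0 : ℝ) 1 = Ioc 0 c := by
    ext t
    simp only [mem_inter_iff, mem_Iic, mem_Ioc]
    exact ⟨fun h => ⟨h.2.1, h.1⟩, fun h => ⟨h.2, h.1, h.2.trans hc.2⟩⟩
  rw [this]
  simp [hc.1]

theorem zeroOne_mem (S : Finset (Fin K)) (j : Fin K) : zeroOne S j ∈ Icc (0 : ℝ) 1 := by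
  unfold zeroOne; split_ifs <;> simp

theorem sum_mul_nonneg {v : Fin K → ℝ} (hv : ∀ j, 0 ≤ v j) : 0 ≤ ∑ j, (α j : ℝ) * v j :=
  Finset.sum_nonneg fun j _ => mul_nonneg (α j).2 (hv j)

/-- Truncating c at n preserves its order and reduces to the finite rearrangement inequality; then n
→ ∞. -/
theorem sum_mul_sorted_le_of_antitone (hα : Antitone α) {c : Fin K → ℝ≥0∞}
    {τ : Equiv.Perm (Fin K)} (hτ : Monotone (c ∘ τ)) :
    ∑ j, (α j : ℝ≥0∞) * c (τ j) ≤ ∑ j, (α j : ℝ≥0∞) * c j := by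
  have hlim : Tendsto (fun n : ℕ => ∑ j, (α j : ℝ≥0∞) * min (c (τ j)) n) atTop
      (𝓝 (∑ j, (α j : ℝ≥0∞) * c (τ j))) := by
    refine tendsto_finsetSum _ fun j _ => ENNReal.Tendsto.const_mul ?_ (Or.inr ENNReal.coe_ne_top)
    have := (tendsto_const_nhds (x := c (τ j))).min ENNReal.tendsto_nat_nhds_top
    rwa [min_eq_left le_top] at this
  refine le_of_tendsto' hlim fun n => ?_
  have hne : ∀ j, min (c j) n ≠ ⊤ := fun j =>
    ne_top_of_le_ne_top (ENNReal.natCast_ne_top n) (min_le_right _ _)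
  set d : Fin K → ℝ≥0 := fun j => (min (c j) n).toNNReal with hd
  have hcd : ∀ j, min (c j) n = d j := fun j => (ENNReal.coe_toNNReal (hne j)).symm
  have hdm : Monotone (d ∘ τ) := fun i j hij =>
    ENNReal.toNNReal_mono (hne _) (min_le_min_right _ (hτ hij))
  have h := (hα.antivary hdm).sum_mul_le_sum_mul_comp_perm (σ := τ.symm)
  simp only [Function.comp_apply, Equiv.apply_symm_apply] at h
  calc ∑ j, (α j : ℝ≥0∞) * min (c (τ j)) n ≤ ∑ j, (α j : ℝ≥0∞) * min (c j) n := by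
        simp only [hcd]; exact_mod_cast h
    _ ≤ _ := Finset.sum_le_sum fun j _ => by gcongr; exact min_le_left _ _

variable [NeZero K]

/-- On a cone of vectors with a common order the decay functional is linear, so by the layer cake
formula it is not smaller at `v` than at one of the superlevel sets of `v`. -/
theorem exists_zeroOne_le (hα : Antitone α) {v : Fin K → ℝ} (h0 : v 0 = 1)
    (hv : ∀ j, v j ∈ Icc (0 : ℝ) 1) :
    ∃ S : Finset (Fin K), 0 ∈ S ∧ decayFunctional α (zeroOne S) ≤ decayFunctional α v := by
  classical
  set τ := Tuple.sort v
  have hτ : Monotone (v ∘ τ) := Tuple.monotone_sort v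
  let S : ℝ → Finset (Fin K) := fun t => Finset.univ.filter fun j => t ≤ v j
  have hS : ∀ t j, zeroOne (S t) j = if t ≤ v j then 1 else 0 := fun t j => by
    simp [zeroOne, S]
  -- The permutation sorting v sorts every superlevel indicator as well, so one linear formula
  -- serves for all t.
  have hmono : ∀ t, Monotone (zeroOne (S t) ∘ τ) := by
    intro t i j hij
    simp only [Function.comp_apply, hS]
    have := hτ hij
    simp only [Function.comp_apply] at this
    split_ifs with h1 h2 <;> first | exact le_rfl | exact zero_le_one | exact absurd (h1.trans this) h2
  have hint : ∀ j, Integrable (fun t => zeroOne (S t) j) (volume.restrict (Ioc 0 1)) := by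
    intro j; simp only [hS]; exact (integral_Ioc_ite_le (hv j)).1
  have hval : ∀ j, ∫ t in Ioc (0 : ℝ) 1, zeroOne (S t) j = v j := by
    intro j; simp only [hS]; exact (integral_Ioc_ite_le (hv j)).2
  have hi1 : Integrable (fun t => ∑ j, (α j : ℝ) * zeroOne (S t) j)
      (volume.restrict (Ioc (0 : ℝ) 1)) :=
    integrable_finsetSum _ fun j _ => (hint j).const_mul _
  have hi2 : Integrable (fun t => ∑ j, (α j : ℝ) * zeroOne (S t) (τ j))
      (volume.restrict (Ioc (0 : ℝ) 1)) :=
    integrable_finsetSum _ fun j _ => (hint (τ j)).const_mul _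
  have hfun : (fun t => decayFunctional α (zeroOne (S t))) = fun t =>
      2 * ∑ j, (α j : ℝ) * zeroOne (S t) j - ∑ j, (α j : ℝ) * zeroOne (S t) (τ j) :=
    funext fun t => decayFunctional_eq_of_monotone hα (hmono t)
  have hI : Integrable (fun t => decayFunctional α (zeroOne (S t)))
      (volume.restrict (Ioc (0 : ℝ) 1)) := by
    rw [hfun]; exact (hi1.const_mul 2).sub hi2
  have hval2 : ∫ t in Ioc (0 : ℝ) 1, decayFunctional α (zeroOne (S t)) = decayFunctional α v := by
    rw [hfun, integral_sub (hi1.const_mul 2) hi2, integral_const_mul,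
      integral_finsetSum _ fun j _ => (hint j).const_mul _,
      integral_finsetSum _ fun j _ => (hint (τ j)).const_mul _,
      decayFunctional_eq_of_monotone hα hτ]
    simp only [integral_const_mul, hval]
  have : IsProbabilityMeasure (volume.restrict (Ioc (0 : ℝ) 1)) := ⟨by simp⟩
  -- Some value is at most the mean. Discarding the null complement of (0,1] keeps t ≤ 1 = v 0,
  -- which puts 0 in the superlevel set.
  obtain ⟨t, ht, hle⟩ := exists_notMem_null_le_integral (N := (Ioc (0 : ℝ) 1)ᶜ) hI
    (by rw [Measure.restrict_apply measurableSet_Ioc.compl]; simp)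
  rw [hval2] at hle
  simp only [mem_compl_iff, not_not] at ht
  exact ⟨S t, by simp [S, h0, ht.2], hle⟩

theorem mem_Icc_of_constraint {v : Fin K → ℝ} (h0 : v 0 = 1)
    (h : ∀ j, j ≠ 0 → v j ∈ Icc (0 : ℝ) 1) (j : Fin K) : v j ∈ Icc (0 : ℝ) 1 := by
  by_cases hj : j = 0
  · subst hj; simp [h0]
  · exact h j hj

theorem V_le {v : Fin K → ℝ} (h0 : v 0 = 1) (h : ∀ j, v j ∈ Icc (0 : ℝ) 1) :
    V α ≤ decayFunctional α v := by
  refine csInf_le ⟨0, ?_⟩ ⟨v, ⟨h0, fun j _ => h j⟩, rfl⟩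
  rintro _ ⟨w, ⟨hw0, hw⟩, rfl⟩
  exact (sum_mul_nonneg fun j => (mem_Icc_of_constraint hw0 hw j).1).trans
    (sum_le_decayFunctional α w)

theorem le_V {c : ℝ} (h : ∀ v : Fin K → ℝ, v 0 = 1 → (∀ j, v j ∈ Icc (0 : ℝ) 1) →
    c ≤ decayFunctional α v) : c ≤ V α := by
  refine le_csInf ⟨_, fun _ => 1, ⟨rfl, fun j _ => by simp⟩, rfl⟩ ?_
  rintro _ ⟨w, ⟨hw0, hw⟩, rfl⟩
  exact h w hw0 (mem_Icc_of_constraint hw0 hw)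

theorem one_le_V (hα : IsParameter α) : 1 ≤ V α := by
  refine le_V fun v h0 hv => le_trans ?_ (sum_le_decayFunctional α v)
  have := Finset.single_le_sum (f := fun j => (α j : ℝ) * v j)
    (fun j _ => mul_nonneg (α j).2 (hv j).1) (Finset.mem_univ 0)
  simpa [hα.1, h0] using this

theorem exists_zeroOne_le_V (hα : Antitone α) :
    ∃ S : Finset (Fin K), 0 ∈ S ∧ decayFunctional α (zeroOne S) ≤ V α := by
  obtain ⟨S, hS, hmin⟩ := Finset.exists_min_image
    (Finset.univ.filter fun S : Finset (Fin K) => (0 : Fin K) ∈ S)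
    (fun S => decayFunctional α (zeroOne S)) ⟨{0}, by simp⟩
  refine ⟨S, by simpa using hS, le_V fun v h0 hv => ?_⟩
  obtain ⟨T, hT, hle⟩ := exists_zeroOne_le hα h0 hv
  exact (hmin T (by simpa using hT)).trans hle

/-- Positive homogeneity: dividing by v 0 > 0 gives a vector admissible in V(α). For v 0 = 0 the
left side vanishes. -/
theorem V_mul_le_decayFunctional {v : Fin K → ℝ} (h : ∀ j, v j ∈ Icc (0 : ℝ) (v 0)) :
    V α * v 0 ≤ decayFunctional α v := by
  rcases (h 0).1.eq_or_lt with h0 | h0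
  · rw [← h0, mul_zero]
    exact (sum_mul_nonneg fun j => (h j).1).trans (sum_le_decayFunctional α v)
  · have h1 : V α ≤ decayFunctional α (fun j => v j / v 0) :=
      V_le (div_self h0.ne') fun j => ⟨div_nonneg (h j).1 h0.le, div_le_one_of_le₀ (h j).2 h0.le⟩
    obtain ⟨τ, hτ, -⟩ := exists_decayFunctional_eq α (fun j => v j / v 0)
    have h2 := le_decayFunctional α v τ
    have h3 : ∀ σ : Equiv.Perm (Fin K), ∑ j, (α j : ℝ) * (v (σ j) / v 0) =
        (∑ j, (α j : ℝ) * v (σ j)) / v 0 := fun σ => by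
      rw [Finset.sum_div]; exact Finset.sum_congr rfl fun j _ => by ring
    have h4 := h3 1
    simp only [Equiv.Perm.coe_one, id_eq] at h4
    rw [hτ, h3, h4, mul_div_assoc', ← sub_div, le_div_iff₀ h0] at h1
    exact h1.trans h2

/-- The weighted inequality behind the upper bound on the second moment. Infinite entries are
allowed. -/
theorem exists_perm_V_mul_add_le (hα : IsParameter α) (a : Fin K → ℝ≥0∞) :
    ∃ τ : Equiv.Perm (Fin K), ENNReal.ofReal (V α) * a 0 + ∑ j, (α j : ℝ≥0∞) * a (τ j) ≤
      2 * ∑ j, (α j : ℝ≥0∞) * a j := by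
  by_cases htop : a 0 = ⊤
  · refine ⟨1, le_of_le_of_eq le_top (Eq.symm ?_)⟩
    rw [ENNReal.mul_eq_top]
    left
    refine ⟨two_ne_zero, ENNReal.sum_eq_top.2 ⟨0, Finset.mem_univ _, ?_⟩⟩
    simp [hα.1, htop]
  set τ := Tuple.sort a
  have hτ : Monotone (a ∘ τ) := Tuple.monotone_sort a
  refine ⟨τ, ?_⟩
  -- The part of a below a 0 and the excess over it are both nondecreasing functions of a, so τ
  -- sorts both. The first obeys the homogeneous bound, the second the plain rearrangement
  -- inequality.
  set b : Fin K → ℝ≥0∞ := fun j => min (a j) (a 0) with hb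
  set c : Fin K → ℝ≥0∞ := fun j => a j - a 0 with hc
  have hab : ∀ j, a j = b j + c j := fun j => by
    simp only [hb, hc]
    rcases le_total (a j) (a 0) with h | h
    · rw [min_eq_left h, tsub_eq_zero_of_le h, add_zero]
    · rw [min_eq_right h, add_tsub_cancel_of_le h]
  have hbtop : ∀ j, b j ≠ ⊤ := fun j => ne_top_of_le_ne_top htop (min_le_right _ _)
  have hcτ : ∑ j, (α j : ℝ≥0∞) * c (τ j) ≤ ∑ j, (α j : ℝ≥0∞) * c j :=
    sum_mul_sorted_le_of_antitone hα.2 fun i j hij => tsub_le_tsub_right (hτ hij) _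
  set br : Fin K → ℝ := fun j => (b j).toReal with hbr
  have hb0 : br 0 = (a 0).toReal := by simp [hbr, hb]
  have hbI : ∀ j, br j ∈ Icc (0 : ℝ) (br 0) := fun j =>
    ⟨ENNReal.toReal_nonneg, ENNReal.toReal_mono (hbtop 0) (by simp [hb])⟩
  have hbm : Monotone (br ∘ τ) := fun i j hij =>
    ENNReal.toReal_mono (hbtop _) (min_le_min_right _ (hτ hij))
  have hreal := V_mul_le_decayFunctional (α := α) hbI
  rw [decayFunctional_eq_of_monotone hα.2 hbm] at hreal
  have hVnn : 0 ≤ V α := zero_le_one.trans (one_le_V hα)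
  have hcoe : ∀ σ : Equiv.Perm (Fin K), ∑ j, (α j : ℝ≥0∞) * b (σ j) =
      ENNReal.ofReal (∑ j, (α j : ℝ) * br (σ j)) := fun σ => by
    rw [ENNReal.ofReal_sum_of_nonneg (f := fun j => (α j : ℝ) * br (σ j))
      fun j _ => mul_nonneg (α j).2 (hbI _).1]
    refine Finset.sum_congr rfl fun j _ => ?_
    rw [ENNReal.ofReal_mul (α j).coe_nonneg, ENNReal.ofReal_coe_nnreal, ENNReal.ofReal_toReal (hbtop _)]
  have hcoe1 := hcoe 1
  simp only [Equiv.Perm.coe_one, id_eq] at hcoe1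
  have hmain : ENNReal.ofReal (V α) * a 0 + ∑ j, (α j : ℝ≥0∞) * b (τ j) ≤
      2 * ∑ j, (α j : ℝ≥0∞) * b j := by
    rw [hcoe, hcoe1, ← ENNReal.ofReal_toReal htop, ← hb0, ← ENNReal.ofReal_mul hVnn,
      ← ENNReal.ofReal_add (mul_nonneg hVnn (hbI 0).1) (sum_mul_nonneg fun j => (hbI _).1),
      show (2 : ℝ≥0∞) = ENNReal.ofReal 2 by simp, ← ENNReal.ofReal_mul zero_le_two]
    exact ENNReal.ofReal_le_ofReal (by linarith)
  calc ENNReal.ofReal (V α) * a 0 + ∑ j, (α j : ℝ≥0∞) * a (τ j)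
      = (ENNReal.ofReal (V α) * a 0 + ∑ j, (α j : ℝ≥0∞) * b (τ j)) +
          ∑ j, (α j : ℝ≥0∞) * c (τ j) := by
        rw [add_assoc, ← Finset.sum_add_distrib]
        simp only [← mul_add, ← hab]
    _ ≤ 2 * ∑ j, (α j : ℝ≥0∞) * b j + 2 * ∑ j, (α j : ℝ≥0∞) * c j := by
        refine add_le_add hmain (hcτ.trans ?_)
        -- For the excess one copy of the sum suffices; the second copy is thrown away.
        rw [two_mul]; exact le_self_add
    _ = 2 * ∑ j, (α j : ℝ≥0∞) * a j := by
        rw [← mul_add, ← Finset.sum_add_distrib]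
        simp only [← mul_add, ← hab]

end Combinatorics

/-! ### The optimal temperatures -/

section Optimal

theorem isParameter_alphaStar (K : ℕ) [NeZero K] : IsParameter (alphaStar K) :=
  ⟨by simp [alphaStar], fun i j hij => pow_le_pow_of_le_one (by positivity)
    (by rw [div_le_iff₀ (by norm_num)]; norm_num) hij⟩

/-- Rotation pairs each v (j+1) with α*ⱼ = 2α*ⱼ₊₁ and v 0 with the last weight. All terms except
those of v 0 = 1 then cancel, so the bound does not depend on v. -/
theorem le_V_alphaStar (K : ℕ) [NeZero K] : 2 - (1 / 2 : ℝ) ^ (K - 1) ≤ V (alphaStar K) := by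
  obtain ⟨n, rfl⟩ := Nat.exists_eq_succ_of_ne_zero (NeZero.ne K)
  refine le_V fun v h0 hv => le_trans ?_ (le_decayFunctional _ v (finRotate (n + 1)))
  have h1 : ∑ j, (alphaStar (n + 1) j : ℝ) * v j =
      1 + ∑ j : Fin n, (1 / 2 : ℝ) ^ ((j : ℕ) + 1) * v j.succ := by
    rw [Fin.sum_univ_succ]
    have : v 0 = 1 := h0
    simp [alphaStar, this]
  have h2 : ∑ j, (alphaStar (n + 1) j : ℝ) * v (finRotate (n + 1) j) =
      ∑ j : Fin n, (1 / 2 : ℝ) ^ (j : ℕ) * v j.succ + (1 / 2 : ℝ) ^ n := by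
    rw [Fin.sum_univ_castSucc]
    have : v 0 = 1 := h0
    simp [alphaStar, this]
  have h3 : ∑ j : Fin n, (1 / 2 : ℝ) ^ (j : ℕ) * v j.succ =
      2 * ∑ j : Fin n, (1 / 2 : ℝ) ^ ((j : ℕ) + 1) * v j.succ := by
    rw [Finset.mul_sum]; exact Finset.sum_congr rfl fun j _ => by ring
  have h4 : n.succ - 1 = n := rfl
  rw [h4]
  linarith

/-- Test vector: ones at 0 and at the indices above k. Swapping 0 and k moves the ones to the
indices from k on, which is the increasing arrangement. -/
theorem V_le_two_add_sub {K : ℕ} [NeZero K] {α : Fin K → ℝ≥0} (hα : IsParameter α) (k : Fin K) :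
    V α ≤ 2 + ∑ j ∈ Finset.Ioi k, (α j : ℝ) - α k := by
  classical
  set S : Finset (Fin K) := insert 0 (Finset.Ioi k) with hS
  have h0S : (0 : Fin K) ∉ Finset.Ioi k := by simp
  have hswap : ∀ j, zeroOne S (Equiv.swap 0 k j) = if k ≤ j then 1 else 0 := by
    intro j
    simp only [zeroOne, hS, Finset.mem_insert, Finset.mem_Ioi]
    rcases eq_or_ne j 0 with rfl | hj0
    · by_cases hk : k = 0 <;> simp [hk]
    · rcases eq_or_ne j k with rfl | hjk
      · simp
      · rw [Equiv.swap_apply_of_ne_of_ne hj0 hjk]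
        simp [hj0, hjk.symm.le_iff_lt]
  have hm : Monotone (zeroOne S ∘ Equiv.swap 0 k) := by
    intro i j hij
    simp only [Function.comp_apply, hswap]
    split_ifs with h1 h2 <;> first | exact le_rfl | exact zero_le_one | exact absurd (h1.trans hij) h2
  have h1 : V α ≤ decayFunctional α (zeroOne S) :=
    V_le (by simp [zeroOne, hS]) (zeroOne_mem S)
  rw [decayFunctional_eq_of_monotone hα.2 hm] at h1
  have h2 : ∑ j, (α j : ℝ) * zeroOne S j = 1 + ∑ j ∈ Finset.Ioi k, (α j : ℝ) := by
    simp only [zeroOne, mul_ite, mul_one, mul_zero, Finset.sum_ite_mem, Finset.univ_inter, hS]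
    rw [Finset.sum_insert h0S, hα.1]; simp
  have h3 : ∑ j, (α j : ℝ) * zeroOne S (Equiv.swap 0 k j) =
      α k + ∑ j ∈ Finset.Ioi k, (α j : ℝ) := by
    have : ∀ j, zeroOne S (Equiv.swap 0 k j) = if j ∈ Finset.Ici k then 1 else 0 := by
      simpa only [Finset.mem_Ici] using hswap
    simp only [this, mul_ite, mul_one, mul_zero, Finset.sum_ite_mem, Finset.univ_inter]
    rw [← Finset.Ioi_insert, Finset.sum_insert (by simp)]
  linarith

theorem V_le_of_isParameter {K : ℕ} [NeZero K] {α : Fin K → ℝ≥0} (hα : IsParameter α) :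
    V α ≤ 2 - (1 / 2 : ℝ) ^ (K - 1) := by
  by_contra! hlt
  obtain ⟨n, rfl⟩ := Nat.exists_eq_succ_of_ne_zero (NeZero.ne K)
  -- If V(α) exceeded the claimed maximum, every αₖ would be smaller than its tail plus 2^{-n}.
  -- Summing from the last index back then forces α₀ < 1.
  have hstep : ∀ k : Fin (n + 1), (α k : ℝ) < ∑ j ∈ Finset.Ioi k, (α j : ℝ) + (1 / 2) ^ n := by
    intro k
    have h1 := V_le_two_add_sub hα k
    have h2 : n.succ - 1 = n := rfl
    rw [h2] at hlt
    linarith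
  have key : ∀ m : ℕ, ∀ k : Fin (n + 1), (k : ℕ) + m = n →
      ∑ j ∈ Finset.Ioi k, (α j : ℝ) ≤ (1 / 2) ^ (k : ℕ) - (1 / 2) ^ n := by
    intro m
    induction m with
    | zero =>
      intro k hk
      have : Finset.Ioi k = ∅ := by
        ext j; simp only [Finset.mem_Ioi, Fin.lt_def]; simp; omega
      have hk' : (k : ℕ) = n := hk
      rw [this, hk']; simp
    | succ m ih =>
      intro k hk
      let l : Fin (n + 1) := ⟨k + 1, by omega⟩
      have : Finset.Ioi k = insert l (Finset.Ioi l) := by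
        rw [Finset.Ioi_insert]
        ext j; simp only [Finset.mem_Ioi, Finset.mem_Ici, Fin.lt_def, Fin.le_def, l]; omega
      rw [this, Finset.sum_insert (by simp)]
      have h1 := ih l (by simp only [l]; omega)
      have h2 := hstep l
      have h3 : (1 / 2 : ℝ) ^ (l : ℕ) = (1 / 2) ^ (k : ℕ) / 2 := by simp only [l, pow_succ]; ring
      linarith
  have h1 := key n 0 (by simp)
  have h2 := hstep 0
  have h0 : α 0 = 1 := hα.1
  simp only [h0, NNReal.coe_one, Fin.val_zero, pow_zero] at h1 h2
  linarith

theorem V_alphaStar (K : ℕ) [NeZero K] : V (alphaStar K) = 2 - (1 / 2 : ℝ) ^ (K - 1) :=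
  le_antisymm (V_le_of_isParameter (isParameter_alphaStar K)) (le_V_alphaStar K)

end Optimal

/-! ### The exponential e^{-t} on [0,∞] -/

section ExpNeg

theorem expNeg_add (a b : ℝ≥0∞) : expNeg (a + b) = expNeg a * expNeg b := by
  unfold expNeg
  rw [← EReal.exp_add, EReal.coe_ennreal_add, EReal.neg_add (Or.inl (by simp)) (Or.inr (by simp)),
    sub_eq_add_neg]

@[simp] theorem expNeg_zero : expNeg 0 = 1 := by simp [expNeg]

@[simp] theorem expNeg_top : expNeg ⊤ = 0 := by simp [expNeg]

theorem expNeg_antitone : Antitone expNeg := fun _ _ h =>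
  EReal.exp_monotone (EReal.neg_le_neg_iff.2 (EReal.coe_ennreal_le_coe_ennreal_iff.2 h))

theorem expNeg_le_one (a : ℝ≥0∞) : expNeg a ≤ 1 :=
  expNeg_zero ▸ expNeg_antitone (zero_le (a := a))

theorem expNeg_ne_top (a : ℝ≥0∞) : expNeg a ≠ ⊤ :=
  ne_top_of_le_ne_top ENNReal.one_ne_top (expNeg_le_one a)

theorem expNeg_ne_zero {a : ℝ≥0∞} (ha : a ≠ ⊤) : expNeg a ≠ 0 := by
  unfold expNeg; simpa using ha

theorem expNeg_ofReal {t : ℝ} (ht : 0 ≤ t) :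
    expNeg (ENNReal.ofReal t) = ENNReal.ofReal (Real.exp (-t)) := by
  unfold expNeg
  rw [EReal.coe_ennreal_ofReal, max_eq_left ht, ← EReal.coe_neg, EReal.exp_coe]

theorem expNeg_sum {ι : Type*} (s : Finset ι) (f : ι → ℝ≥0∞) :
    expNeg (∑ i ∈ s, f i) = ∏ i ∈ s, expNeg (f i) := by
  classical
  induction s using Finset.induction_on with
  | empty => simp
  | insert i s hi ih => rw [Finset.sum_insert hi, Finset.prod_insert hi, expNeg_add, ih]

theorem expNeg_rpow {η : ℝ} (hη : 0 < η) (a : ℝ≥0∞) :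
    expNeg a ^ η = expNeg (ENNReal.ofReal η * a) := by
  rcases eq_or_ne a ⊤ with rfl | ha
  · rw [ENNReal.mul_top (by simpa using hη), expNeg_top, ENNReal.zero_rpow_of_pos hη]
  · rw [← ENNReal.ofReal_toReal ha, ← ENNReal.ofReal_mul hη.le,
      expNeg_ofReal ENNReal.toReal_nonneg,
      expNeg_ofReal (mul_nonneg hη.le ENNReal.toReal_nonneg),
      ENNReal.ofReal_rpow_of_pos (Real.exp_pos _), ← Real.exp_mul]
    congr 2; ring

theorem measurable_expNeg : Measurable expNeg := by
  unfold expNeg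
  exact EReal.measurable_exp.comp (measurable_coe_ennreal_ereal.neg)

theorem expNeg_rpow_neg_mul {η : ℝ} (h0 : 0 < η) (a : ℝ≥0∞) :
    expNeg a ^ (-(1 - η)) * expNeg a = expNeg (ENNReal.ofReal η * a) := by
  rw [← expNeg_rpow h0]
  -- At a = ∞ the negative power may be ∞, but ∞ · 0 = 0 agrees with the right side because η > 0.
  rcases eq_or_ne (expNeg a) 0 with h | h
  · rw [h, mul_zero, ENNReal.zero_rpow_of_pos h0]
  · conv_lhs => rw [← ENNReal.rpow_one (expNeg a), ← ENNReal.rpow_mul,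
      ← ENNReal.rpow_add _ _ h (expNeg_ne_top a)]
    congr 1; ring

end ExpNeg

/-- For α = 0 the temperature is ∞ and both sides are 0, even at x = ∞, so infinite temperature
needs no separate treatment later. -/
theorem div_temperature {ε : ℝ} (hε : 0 < ε) (α : ℝ≥0) (x : ℝ≥0∞) :
    x / (ENNReal.ofReal ε / α) = α * x / ENNReal.ofReal ε := by
  rw [div_eq_mul_inv, ENNReal.inv_div (Or.inl ENNReal.coe_ne_top) (Or.inr (by simpa using hε)),
    mul_comm, ENNReal.mul_div_right_comm]

/-! ### Estimates for Gibbs measures -/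

section Gibbs

variable {𝒳 : Type*} [MeasurableSpace 𝒳] {γ : Measure 𝒳} {I : 𝒳 → ℝ≥0∞}

theorem gibbs_univ (γ : Measure 𝒳) (I : 𝒳 → ℝ≥0∞) (T : ℝ≥0∞) :
    gibbs γ I T univ = (partitionFunction γ I T)⁻¹ * partitionFunction γ I T := by
  simp [gibbs, partitionFunction]

theorem partitionFunction_ne {T : ℝ≥0∞} (h : IsProbabilityMeasure (gibbs γ I T)) :
    partitionFunction γ I T ≠ 0 ∧ partitionFunction γ I T ≠ ⊤ := by
  have h1 := h.measure_univ
  rw [gibbs_univ] at h1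
  constructor <;> intro h2 <;> rw [h2] at h1 <;> simp at h1

theorem gibbs_apply (γ : Measure 𝒳) (I : 𝒳 → ℝ≥0∞) (T : ℝ≥0∞) {B : Set 𝒳} (hB : MeasurableSet B) :
    gibbs γ I T B = (partitionFunction γ I T)⁻¹ * ∫⁻ x in B, expNeg (I x / T) ∂γ := by
  simp [gibbs, withDensity_apply _ hB]

theorem le_setLIntegral_expNeg (γ : Measure 𝒳) {ε : ℝ} (hε : 0 < ε) (α : ℝ≥0) {B : Set 𝒳}
    (hB : MeasurableSet B) {b : ℝ≥0∞} (hb : ∀ x ∈ B, I x ≤ b) :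
    expNeg (α * b / ENNReal.ofReal ε) * γ B ≤
      ∫⁻ x in B, expNeg (I x / (ENNReal.ofReal ε / α)) ∂γ := by
  rw [← setLIntegral_const]
  refine setLIntegral_mono' hB fun x hx => ?_
  rw [div_temperature hε]
  exact expNeg_antitone (by gcongr; exact hb x hx)

/-- The partition function increases with temperature; comparing with ε = 1 gives a bound uniform in
small ε. -/
theorem partitionFunction_le_one {ε : ℝ} (hε1 : ε ≤ 1) (α : ℝ≥0) :
    partitionFunction γ I (ENNReal.ofReal ε / α) ≤ partitionFunction γ I (ENNReal.ofReal 1 / α) := by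
  refine lintegral_mono fun x => expNeg_antitone ?_
  gcongr

theorem le_gibbs_apply {ε : ℝ} (hε : 0 < ε) (hε1 : ε ≤ 1) (α : ℝ≥0) {B : Set 𝒳}
    (hB : MeasurableSet B) {b : ℝ≥0∞} (hb : ∀ x ∈ B, I x ≤ b) :
    (partitionFunction γ I (ENNReal.ofReal 1 / α))⁻¹ * γ B * expNeg (α * b / ENNReal.ofReal ε) ≤
      gibbs γ I (ENNReal.ofReal ε / α) B := by
  rw [gibbs_apply _ _ _ hB, mul_assoc, mul_comm (γ B)]
  gcongr
  · exact partitionFunction_le_one hε1 α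
  · exact le_setLIntegral_expNeg γ hε α hB hb

/-- The power leaves the density e^{-ηαI/ε}, which is at most e^{-αI} once ε ≤ η, so its integral is
bounded uniformly. The normalizing constant is bounded below by its part over {I ≤ δ}. -/
theorem lintegral_rpow_neg_gibbs_le (hI : Measurable I) {ε η : ℝ} (hε : 0 < ε) (hεη : ε ≤ η)
    (α : ℝ≥0) {δ : ℝ≥0∞} :
    ∫⁻ x, expNeg (α * I x / ENNReal.ofReal ε) ^ (-(1 - η))
        ∂(gibbs γ I (ENNReal.ofReal ε / α)) ≤
      partitionFunction γ I (ENNReal.ofReal 1 / α) *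
        (expNeg (α * δ / ENNReal.ofReal ε) * γ {x | I x ≤ δ})⁻¹ := by
  have hη0 : 0 < η := hε.trans_le hεη
  have hm : ∀ T : ℝ≥0∞, Measurable fun x => expNeg (I x / T) := fun T =>
    measurable_expNeg.comp (hI.div_const T)
  have hm2 : Measurable fun x => expNeg (α * I x / ENNReal.ofReal ε) :=
    measurable_expNeg.comp ((hI.const_mul _).div_const _)
  unfold gibbs
  rw [lintegral_smul_measure, lintegral_withDensity_eq_lintegral_mul _ (hm _)
    (hm2.pow_const _), smul_eq_mul, mul_comm]
  gcongr
  · refine lintegral_mono fun x => ?_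
    simp only [Pi.mul_apply, div_temperature hε, div_temperature one_pos]
    rw [mul_comm, expNeg_rpow_neg_mul hη0]
    refine expNeg_antitone ?_
    rw [ENNReal.ofReal_one, div_one, ← mul_div_assoc, mul_comm (ENNReal.ofReal η), mul_div_assoc]
    refine le_mul_of_one_le_right' ?_
    rw [ENNReal.le_div_iff_mul_le (Or.inl (by simpa using hε)) (Or.inl ENNReal.ofReal_ne_top),
      one_mul]
    exact ENNReal.ofReal_le_ofReal hεη
  · exact (le_setLIntegral_expNeg γ hε α (hI measurableSet_Iic) fun x hx => hx).trans
      (setLIntegral_le_lintegral _ _)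

end Gibbs

/-! ### Positivity of γ from the large deviation principle -/

section Positivity

variable {𝒳 : Type*} [TopologicalSpace 𝒳] [MeasurableSpace 𝒳]
  {μ : ℝ → Measure 𝒳} {γ : Measure 𝒳} {I : 𝒳 → ℝ≥0∞}

theorem IsGibbsFamily.infOver_univ (hμ : IsGibbsFamily μ γ I) : infOver I univ = 0 := by
  have h1 := hμ.ldp.upper_bound univ isClosed_univ
  have h2 : (fun ε : ℝ => (ε : EReal) * ENNReal.log (μ ε univ)) =ᶠ[𝓝[>] (0 : ℝ)] fun _ => 0 := by
    filter_upwards [self_mem_nhdsWithin] with ε hε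
    have := hμ.isProbabilityMeasure ε hε
    rw [measure_univ, ENNReal.log_one, mul_zero]
  rw [limsup_congr h2, limsup_const, EReal.le_neg, neg_zero] at h1
  exact le_antisymm (by exact_mod_cast h1) (zero_le)

variable [BorelSpace 𝒳]

theorem IsRateFunction.measurable [T2Space 𝒳] (h : IsRateFunction I) : Measurable I := by
  refine measurable_of_Iic fun a => ?_
  rcases eq_or_ne a ⊤ with rfl | ha
  · simp
  · have := (h a.toNNReal).isClosed.measurableSet
    rwa [ENNReal.coe_toNNReal ha] at this

/-- The density vanishes off D, so if γ(G ∩ D) = 0 then every μ^ε(G) is 0, and the lower bound of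
the large deviation principle forces I = ∞ throughout G. -/
theorem IsGibbsFamily.measure_inter_ne_zero (hμ : IsGibbsFamily μ γ I) {G : Set 𝒳} (hG : IsOpen G)
    {x : 𝒳} (hx : x ∈ G) (hIx : I x < ∞) : γ (G ∩ {x | I x < ∞}) ≠ 0 := by
  intro h0
  have hz : ∀ ε : ℝ, 0 < ε → μ ε G = 0 := by
    intro ε hε
    rw [hμ.eq_gibbs ε hε, gibbs_apply _ _ _ hG.measurableSet, mul_eq_zero]
    right
    refine lintegral_eq_zero_of_ae_eq_zero ?_
    refine (ae_restrict_iff' hG.measurableSet).2 (measure_mono_null ?_ h0)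
    intro y hy
    simp only [mem_compl_iff, mem_ofPred_eq, Classical.not_imp] at hy
    refine ⟨hy.1, mem_ofPred_eq ▸ lt_top_iff_ne_top.2 fun htop => hy.2 ?_⟩
    rw [htop, ENNReal.top_div_of_ne_top ENNReal.ofReal_ne_top]
    simp
  have h1 := hμ.ldp.lower_bound G hG
  have h2 : (fun ε : ℝ => (ε : EReal) * ENNReal.log (μ ε G)) =ᶠ[𝓝[>] (0 : ℝ)] fun _ => ⊥ := by
    filter_upwards [self_mem_nhdsWithin] with ε hε
    rw [hz ε hε, ENNReal.log_zero, EReal.coe_mul_bot_of_pos hε]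
  rw [liminf_congr h2, liminf_const, le_bot_iff, EReal.neg_eq_bot_iff,
    EReal.coe_ennreal_eq_top_iff] at h1
  have h3 : infOver I G ≤ I x := iInf₂_le x hx
  rw [h1, top_le_iff] at h3
  exact hIx.ne h3

theorem IsGibbsFamily.measure_inter_le_ne_zero (hμ : IsGibbsFamily μ γ I)
    (hI : ContinuousOn I {x | I x < ∞}) {A : Set 𝒳}
    (hAI : (Subtype.val ⁻¹' A : Set {x : 𝒳 // I x < ∞}) ⊆
      closure (interior (Subtype.val ⁻¹' A : Set {x : 𝒳 // I x < ∞})))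
    {b : ℝ≥0∞} (hb : infOver I A < b) : γ (A ∩ {x | I x ≤ b}) ≠ 0 := by
  obtain ⟨x, hxA, hxb⟩ : ∃ x ∈ A, I x < b := by
    simpa [infOver, iInf_lt_iff] using hb
  have hxD : I x < ∞ := hxb.trans_le le_top
  have hcont : Continuous fun y : {x : 𝒳 // I x < ∞} => I y := hI.domRestrict
  have hopen : IsOpen {y : {x : 𝒳 // I x < ∞} | I y < b} := isOpen_lt hcont continuous_const
  -- A near-minimizer x in A is moved to a nearby y in the relative interior of A ∩ D, still with I
  -- y < b. A relatively open neighbourhood of y is then the trace on D of an open set.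
  obtain ⟨y, hy1, hy2⟩ := mem_closure_iff.1 (hAI (show (⟨x, hxD⟩ : {x : 𝒳 // I x < ∞}) ∈ _ from hxA))
    _ hopen hxb
  obtain ⟨G, hG, hGeq⟩ := isOpen_induced_iff.1 (hopen.inter isOpen_interior)
  have hmem : ∀ z : {x : 𝒳 // I x < ∞}, (z : 𝒳) ∈ G ↔ I z < b ∧ z ∈ interior (Subtype.val ⁻¹' A) :=
    fun z => (Set.ext_iff.1 hGeq z)
  refine fun h0 => hμ.measure_inter_ne_zero hG ((hmem y).2 ⟨hy1, hy2⟩) y.2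
    (measure_mono_null ?_ h0)
  rintro z ⟨hzG, hzD⟩
  have hz := (hmem ⟨z, hzD⟩).1 hzG
  have hzA : (⟨z, hzD⟩ : {x : 𝒳 // I x < ∞}) ∈ Subtype.val ⁻¹' A := interior_subset hz.2
  exact ⟨hzA, hz.1.le⟩

end Positivity

/-! ### Pointwise bounds for the estimator -/

section Estimator

variable {𝒳 : Type*} {K : ℕ} {I : 𝒳 → ℝ≥0∞} {A : Set 𝒳} {α : Fin K → ℝ≥0} {ε : ℝ}

theorem expWeight_le_one (x : Fin K → 𝒳) : expWeight I α ε x ≤ 1 := expNeg_le_one _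

theorem expWeight_eq_prod (x : Fin K → 𝒳) :
    expWeight I α ε x = ∏ j, expNeg (α j * I (x j) / ENNReal.ofReal ε) := by
  simp only [expWeight, ENNReal.div_eq_inv_mul, Finset.mul_sum, expNeg_sum]

theorem sum_expWeight_ne_top (x : Fin K → 𝒳) :
    ∑ τ : Equiv.Perm (Fin K), expWeight I α ε (fun j => x (τ j)) ≠ ⊤ :=
  ENNReal.sum_ne_top.2 fun _ _ => ne_top_of_le_ne_top ENNReal.one_ne_top (expWeight_le_one _)

theorem expWeight_le_sum (x : Fin K → 𝒳) (τ : Equiv.Perm (Fin K)) :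
    expWeight I α ε (fun j => x (τ j)) ≤
      ∑ τ : Equiv.Perm (Fin K), expWeight I α ε (fun j => x (τ j)) :=
  Finset.single_le_sum (f := fun τ : Equiv.Perm (Fin K) => expWeight I α ε (fun j => x (τ j)))
    (fun _ _ => zero_le) (Finset.mem_univ τ)

/-- The denominator is invariant under permuting the points. -/
theorem rho_comp (x : Fin K → 𝒳) (σ : Equiv.Perm (Fin K)) :
    rho I α ε (fun j => x (σ j)) = expWeight I α ε (fun j => x (σ j)) /
      ∑ τ : Equiv.Perm (Fin K), expWeight I α ε (fun j => x (τ j)) := by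
  unfold rho
  congr 1
  exact Fintype.sum_equiv (Equiv.mulLeft σ) _ _ fun τ => rfl

variable [NeZero K]

theorem insEstimator_le_one (x : Fin K → 𝒳) : insEstimator I A α ε x ≤ 1 := by
  unfold insEstimator
  calc _ ≤ ∑ σ : Equiv.Perm (Fin K), rho I α ε (fun j => x (σ j)) * 1 := by
        refine Finset.sum_le_sum fun σ _ => ?_
        gcongr
        exact indicator_le_self' (fun _ _ => zero_le) _
    _ ≤ 1 := by
        simp only [rho_comp, mul_one, ENNReal.div_eq_inv_mul, ← Finset.mul_sum]
        exact ENNReal.inv_mul_le_one _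

/-- With W the weight of the rearranged point, ρ² w ≤ (W/S)² S = W²/S. The weighted inequality
bounds W² by the claimed exponential times a single term of S. -/
theorem rho_sq_mul_le (hα : IsParameter α) (x : Fin K → 𝒳) (σ : Equiv.Perm (Fin K))
    (hx : x (σ 0) ∈ A) :
    rho I α ε (fun j => x (σ j)) ^ 2 * expWeight I α ε x ≤
      expNeg (ENNReal.ofReal (V α) * infOver I A / ENNReal.ofReal ε) := by
  set S := ∑ τ : Equiv.Perm (Fin K), expWeight I α ε (fun j => x (τ j)) with hS
  set W := expWeight I α ε (fun j => x (σ j)) with hW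
  set B := expNeg (ENNReal.ofReal (V α) * infOver I A / ENNReal.ofReal ε)
  have hStop : S ≠ ⊤ := sum_expWeight_ne_top x
  have hxS : expWeight I α ε x ≤ S := expWeight_le_sum x 1
  have hWS : W * W ≤ B * S := by
    obtain ⟨τ, hτ⟩ := exists_perm_V_mul_add_le hα fun j => I (x (σ j))
    have hτS : expWeight I α ε (fun j => x (σ (τ j))) ≤ S := expWeight_le_sum x (σ * τ)
    calc W * W = expNeg ((2 * ∑ j, (α j : ℝ≥0∞) * I (x (σ j))) / ENNReal.ofReal ε) := by
          rw [hW, expWeight, ← expNeg_add, ← ENNReal.add_div, two_mul]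
      _ ≤ expNeg ((ENNReal.ofReal (V α) * infOver I A +
            ∑ j, (α j : ℝ≥0∞) * I (x (σ (τ j)))) / ENNReal.ofReal ε) := by
          refine expNeg_antitone (ENNReal.div_le_div_right (le_trans ?_ hτ) _)
          gcongr
          exact iInf₂_le _ hx
      _ = B * expWeight I α ε (fun j => x (σ (τ j))) := by
          rw [ENNReal.add_div, expNeg_add, expWeight]
      _ ≤ B * S := by gcongr
  rw [rho_comp]
  rcases eq_or_ne S 0 with h0 | h0
  · rw [h0, nonpos_iff_eq_zero] at hxS
    rw [hxS, mul_zero]; exact zero_le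
  calc (W / S) ^ 2 * expWeight I α ε x ≤ (W / S) ^ 2 * S := by gcongr
    _ = W * W / S := by
        rw [sq, mul_assoc, ENNReal.div_mul_cancel h0 hStop, mul_comm, mul_div_assoc]
    _ ≤ B := ENNReal.div_le_of_le_mul hWS

theorem insEstimator_sq_mul_le (hα : IsParameter α) (x : Fin K → 𝒳) :
    insEstimator I A α ε x ^ 2 * expWeight I α ε x ≤
      (Fintype.card (Equiv.Perm (Fin K)) : ℝ≥0∞) ^ 2 *
        expNeg (ENNReal.ofReal (V α) * infOver I A / ENNReal.ofReal ε) := by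
  set q : Equiv.Perm (Fin K) → ℝ≥0∞ := fun σ =>
    rho I α ε (fun j => x (σ j)) * A.indicator (fun _ => (1 : ℝ≥0∞)) (x (σ 0)) with hq
  obtain ⟨σ, -, hσ⟩ := Finset.exists_max_image Finset.univ q Finset.univ_nonempty
  have h1 : insEstimator I A α ε x ≤ Fintype.card (Equiv.Perm (Fin K)) * q σ := by
    have := Finset.sum_le_card_nsmul Finset.univ q (q σ) fun τ hτ => hσ τ hτ
    rwa [Finset.card_univ, nsmul_eq_mul] at this
  calc _ ≤ (Fintype.card (Equiv.Perm (Fin K)) * q σ) ^ 2 * expWeight I α ε x := by gcongr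
    _ = (Fintype.card (Equiv.Perm (Fin K)) : ℝ≥0∞) ^ 2 * (q σ ^ 2 * expWeight I α ε x) := by
        rw [mul_pow, mul_assoc]
    _ ≤ _ := by
        gcongr
        by_cases hx : x (σ 0) ∈ A
        · simpa [hq, hx] using rho_sq_mul_le hα x σ hx
        · simp [hq, hx]

theorem insEstimator_sq_le (hα : IsParameter α) (hA : infOver I A ≠ ⊤) (hε : 0 < ε) {κ : ℝ}
    (h0 : 0 < κ) (h1 : κ ≤ 1) (x : Fin K → 𝒳) :
    insEstimator I A α ε x ^ 2 ≤
      ((Fintype.card (Equiv.Perm (Fin K)) : ℝ≥0∞) ^ 2 *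
        expNeg (ENNReal.ofReal (V α) * infOver I A / ENNReal.ofReal ε)) ^ κ *
      ∏ j, expNeg (α j * I (x j) / ENNReal.ofReal ε) ^ (-κ) := by
  set C := (Fintype.card (Equiv.Perm (Fin K)) : ℝ≥0∞) ^ 2 *
        expNeg (ENNReal.ofReal (V α) * infOver I A / ENNReal.ofReal ε) with hC
  -- Where the weight vanishes the right side must be ∞, which requires C ≠ 0 and hence I(A) < ∞.
  have hC0 : C ≠ 0 := by
    refine mul_ne_zero (pow_ne_zero _ (by simp)) (expNeg_ne_zero ?_)
    exact ENNReal.div_ne_top (ENNReal.mul_ne_top ENNReal.ofReal_ne_top hA) (by simpa using hε)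
  have hCtop : C ≠ ⊤ :=
    ENNReal.mul_ne_top (ENNReal.pow_ne_top (ENNReal.natCast_ne_top _)) (expNeg_ne_top _)
  have hprod : ∏ j, expNeg (α j * I (x j) / ENNReal.ofReal ε) ^ (-κ) =
      (expWeight I α ε x ^ κ)⁻¹ := by
    rw [expWeight_eq_prod, ← ENNReal.prod_rpow_of_nonneg h0.le, ENNReal.prod_inv_distrib]
    · simp only [ENNReal.rpow_neg]
    · exact fun i _ j _ _ => Or.inr (ENNReal.rpow_ne_top_of_nonneg h0.le (expNeg_ne_top _))
  have hWtop : expWeight I α ε x ^ κ ≠ ⊤ := ENNReal.rpow_ne_top_of_nonneg h0.le (expNeg_ne_top _)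
  rw [hprod, ← div_eq_mul_inv, ENNReal.le_div_iff_mul_le
    (Or.inr (by simp [hC0, hCtop])) (Or.inl hWtop)]
  calc insEstimator I A α ε x ^ 2 * expWeight I α ε x ^ κ
      ≤ (insEstimator I A α ε x ^ 2) ^ κ * expWeight I α ε x ^ κ := by
        gcongr
        conv_lhs => rw [← ENNReal.rpow_one (insEstimator I A α ε x ^ 2)]
        exact ENNReal.rpow_le_rpow_of_exponent_ge (pow_le_one₀ zero_le (insEstimator_le_one x)) h1
    _ = (insEstimator I A α ε x ^ 2 * expWeight I α ε x) ^ κ :=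
        (ENNReal.mul_rpow_of_nonneg _ _ h0.le).symm
    _ ≤ C ^ κ := ENNReal.rpow_le_rpow (insEstimator_sq_mul_le hα x) h0.le

theorem insEstimator_eq_zero (hα : IsParameter α) (hA : infOver I A = ⊤) (x : Fin K → 𝒳) :
    insEstimator I A α ε x = 0 := by
  refine Finset.sum_eq_zero fun σ _ => ?_
  by_cases hx : x (σ 0) ∈ A
  · have hI : I (x (σ 0)) = ⊤ := top_le_iff.1 (hA ▸ iInf₂_le _ hx)
    have : expWeight I α ε (fun j => x (σ j)) = 0 := by
      have hs : ∑ j, (α j : ℝ≥0∞) * I (x (σ j)) = ⊤ :=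
        ENNReal.sum_eq_top.2 ⟨0, Finset.mem_univ _, by simp [hα.1, hI]⟩
      rw [expWeight, hs, ENNReal.top_div_of_ne_top ENNReal.ofReal_ne_top, expNeg_top]
    rw [rho_comp, this]; simp
  · simp [hx]

/-- Lower bound for the estimator at a point whose rearrangement has nearly prescribed levels. -/
theorem le_insEstimator {x : Fin K → 𝒳} {σ : Equiv.Perm (Fin K)} (hx : x (σ 0) ∈ A)
    {w W : ℝ≥0∞} (hw : w ≤ expWeight I α ε (fun j => x (σ j)))
    (hW : ∀ τ : Equiv.Perm (Fin K), expWeight I α ε (fun j => x (τ j)) ≤ W) :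
    w / (Fintype.card (Equiv.Perm (Fin K)) * W) ≤ insEstimator I A α ε x := by
  have h1 : rho I α ε (fun j => x (σ j)) * A.indicator (fun _ => (1 : ℝ≥0∞)) (x (σ 0)) ≤
      insEstimator I A α ε x :=
    Finset.single_le_sum (f := fun σ : Equiv.Perm (Fin K) =>
      rho I α ε (fun j => x (σ j)) * A.indicator (fun _ => (1 : ℝ≥0∞)) (x (σ 0)))
      (fun _ _ => zero_le) (Finset.mem_univ σ)
  refine le_trans ?_ h1
  rw [indicator_of_mem hx, mul_one, rho_comp]
  refine ENNReal.div_le_div hw ?_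
  have := Finset.sum_le_card_nsmul Finset.univ
    (fun τ : Equiv.Perm (Fin K) => expWeight I α ε (fun j => x (τ j))) W fun τ _ => hW τ
  rwa [Finset.card_univ, nsmul_eq_mul] at this

theorem measurable_insEstimator [MeasurableSpace 𝒳] (hI : Measurable I) (hA : MeasurableSet A) :
    Measurable (insEstimator I A α ε) := by
  have hw : Measurable (expWeight I α ε) :=
    measurable_expNeg.comp ((Finset.measurable_sum _ fun j _ =>
      (hI.comp (measurable_pi_apply j)).const_mul _).div_const _)
  have hp : ∀ σ : Equiv.Perm (Fin K), Measurable fun (x : Fin K → 𝒳) j => x (σ j) := fun σ =>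
    measurable_pi_lambda _ fun j => measurable_pi_apply _
  have hr : Measurable (rho I α ε) :=
    hw.div (Finset.measurable_sum _ fun τ _ => hw.comp (hp τ))
  exact Finset.measurable_sum _ fun σ _ => (hr.comp (hp σ)).mul
    ((measurable_const.indicator hA).comp (measurable_pi_apply (σ 0)))

end Estimator

theorem lintegral_pi_prod {ι : Type*} [Fintype ι] {X : ι → Type*} [∀ i, MeasurableSpace (X i)]
    (ν : ∀ i, Measure (X i)) [∀ i, IsProbabilityMeasure (ν i)] {f : ∀ i, X i → ℝ≥0∞}
    (hf : ∀ i, Measurable (f i)) :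
    ∫⁻ x, ∏ i, f i (x i) ∂(Measure.pi ν) = ∏ i, ∫⁻ x, f i x ∂(ν i) := by
  rw [lintegral_prod_eq_prod_lintegral_of_indepFun _ (fun i (x : ∀ i, X i) => f i (x i))
    (iIndepFun_pi fun i => (hf i).aemeasurable) fun i => (hf i).comp (measurable_pi_apply i)]
  refine Finset.prod_congr rfl fun i _ => ?_
  exact (measurePreserving_eval ν i).lintegral_comp (hf i)

/-! ### From two-sided exponential bounds to the logarithmic limit -/

section ExponentialRate

theorem log_ofReal_mul_exp {c t : ℝ} (hc : 0 < c) :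
    ENNReal.log (ENNReal.ofReal c * ENNReal.ofReal (Real.exp t)) = ((Real.log c + t : ℝ) : EReal) := by
  rw [← ENNReal.ofReal_mul hc.le, ENNReal.log_ofReal_of_pos (mul_pos hc (Real.exp_pos t)),
    Real.log_mul hc.ne' (Real.exp_pos t).ne', Real.log_exp]

theorem neg_mul_log_eq {c l ε : ℝ} (hc : 0 < c) (hε : 0 < ε) :
    -((ε : EReal) * ENNReal.log (ENNReal.ofReal c * ENNReal.ofReal (Real.exp (-l / ε)))) =
      ((l - ε * Real.log c : ℝ) : EReal) := by
  rw [log_ofReal_mul_exp hc, ← EReal.coe_mul, ← EReal.coe_neg]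
  congr 1
  field_simp
  ring

theorem neg_mul_log_antitone {ε : ℝ} (hε : 0 < ε) {a b : ℝ≥0∞} (h : a ≤ b) :
    -((ε : EReal) * ENNReal.log b) ≤ -((ε : EReal) * ENNReal.log a) :=
  EReal.neg_le_neg_iff.2 (mul_le_mul_of_nonneg_left (ENNReal.log_monotone h)
    (by exact_mod_cast hε.le))

theorem eventually_mul_log_lt (c : ℝ) {δ : ℝ} (hδ : 0 < δ) :
    ∀ᶠ ε in 𝓝[>] (0 : ℝ), |ε * Real.log c| < δ := by
  have h : Tendsto (fun ε : ℝ => |ε * Real.log c|) (𝓝[>] 0) (𝓝 0) := by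
    have : Continuous fun ε : ℝ => |ε * Real.log c| := by fun_prop
    simpa using (this.tendsto 0).mono_left nhdsWithin_le_nhds
  exact h.eventually_lt_const hδ

theorem tendsto_neg_mul_log {E : ℝ → ℝ≥0∞} {L : ℝ}
    (hup : ∀ δ : ℝ, 0 < δ → ∃ c : ℝ≥0∞, c ≠ ⊤ ∧ ∀ᶠ ε in 𝓝[>] (0 : ℝ),
      E ε ≤ c * ENNReal.ofReal (Real.exp (-(L - δ) / ε)))
    (hlo : ∀ δ : ℝ, 0 < δ → ∃ c : ℝ≥0∞, c ≠ 0 ∧ ∀ᶠ ε in 𝓝[>] (0 : ℝ),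
      c * ENNReal.ofReal (Real.exp (-(L + δ) / ε)) ≤ E ε) :
    Tendsto (fun ε : ℝ => -((ε : EReal) * ENNReal.log (E ε))) (𝓝[>] (0 : ℝ)) (𝓝 (L : EReal)) := by
  refine tendsto_order.2 ⟨fun a ha => ?_, fun a ha => ?_⟩
  · obtain ⟨r, har, hrL⟩ := EReal.lt_iff_exists_real_btwn.1 ha
    have hδ : 0 < (L - r) / 2 := by have := EReal.coe_lt_coe_iff.1 hrL; linarith
    obtain ⟨c, hc, hev⟩ := hup _ hδ
    -- Adding 1 keeps the logarithm meaningful when c = 0; below, `min c 1` plays this role when c =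
    -- ∞.
    have hcpos : 0 < c.toReal + 1 := by positivity
    filter_upwards [hev, eventually_mul_log_lt (c.toReal + 1) hδ, self_mem_nhdsWithin]
      with ε h1 h2 hε
    refine har.trans_le (le_trans ?_ (neg_mul_log_antitone hε
      (h1.trans (mul_le_mul_left (b := c) (c := ENNReal.ofReal (c.toReal + 1)) ?_ _))))
    · rw [neg_mul_log_eq hcpos hε]
      refine EReal.coe_le_coe_iff.2 ?_
      have := abs_lt.1 h2
      linarith
    · conv_lhs => rw [← ENNReal.ofReal_toReal hc]
      exact ENNReal.ofReal_le_ofReal (by linarith)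
  · obtain ⟨r, hrL, hra⟩ := EReal.lt_iff_exists_real_btwn.1 ha
    have hδ : 0 < (r - L) / 2 := by have := EReal.coe_lt_coe_iff.1 hrL; linarith
    obtain ⟨c, hc, hev⟩ := hlo _ hδ
    have hm : min c 1 ≠ ⊤ := ne_top_of_le_ne_top ENNReal.one_ne_top (min_le_right _ _)
    have hcpos : 0 < (min c 1).toReal := ENNReal.toReal_pos (by simp [hc, min_eq_iff]) hm
    filter_upwards [hev, eventually_mul_log_lt (min c 1).toReal hδ, self_mem_nhdsWithin]
      with ε h1 h2 hε
    refine lt_of_le_of_lt ((neg_mul_log_antitone hε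
      ((mul_le_mul_left (b := ENNReal.ofReal (min c 1).toReal) (c := c) ?_ _).trans h1)).trans ?_) hra
    · rw [ENNReal.ofReal_toReal hm]; exact min_le_left _ _
    · rw [neg_mul_log_eq hcpos hε]
      refine EReal.coe_le_coe_iff.2 ?_
      have := abs_lt.1 h2
      linarith

end ExponentialRate

/-! ### Upper and lower bounds for the second moment -/

section SecondMoment

theorem expNeg_ofReal_div {t ε : ℝ} (ht : 0 ≤ t) (hε : 0 < ε) :
    expNeg (ENNReal.ofReal t / ENNReal.ofReal ε) = ENNReal.ofReal (Real.exp (-t / ε)) := by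
  rw [← ENNReal.ofReal_div_of_pos hε, expNeg_ofReal (div_nonneg ht hε.le), neg_div]

theorem sum_coe_mul_ofReal {ι : Type*} (s : Finset ι) (α : ι → ℝ≥0) {v : ι → ℝ}
    (hv : ∀ j, 0 ≤ v j) :
    ∑ j ∈ s, (α j : ℝ≥0∞) * ENNReal.ofReal (v j) = ENNReal.ofReal (∑ j ∈ s, (α j : ℝ) * v j) := by
  rw [ENNReal.ofReal_sum_of_nonneg fun j _ => mul_nonneg (α j).coe_nonneg (hv j)]
  refine Finset.sum_congr rfl fun j _ => ?_
  rw [ENNReal.ofReal_mul (α j).coe_nonneg, ENNReal.ofReal_coe_nnreal]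

theorem IsParameter.le_one {K : ℕ} [NeZero K] {α : Fin K → ℝ≥0} (hα : IsParameter α) (j : Fin K) :
    α j ≤ 1 := hα.1 ▸ hα.2 (Fin.zero_le j)

variable {𝒳 : Type*} [TopologicalSpace 𝒳] [MeasurableSpace 𝒳] [BorelSpace 𝒳]
  {μ : ℝ → Measure 𝒳} {γ : Measure 𝒳} {I : 𝒳 → ℝ≥0∞} {A : Set 𝒳}
  {K : ℕ} [NeZero K] {α : Fin K → ℝ≥0}

theorem IsGibbsFamily.measure_sublevel_ne_zero (hμ : IsGibbsFamily μ γ I)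
    (hI : ContinuousOn I {x | I x < ∞}) {b : ℝ≥0∞} (hb : b ≠ 0) : γ {x | I x ≤ b} ≠ 0 := by
  have := hμ.measure_inter_le_ne_zero (A := univ) hI (by simp)
    (b := b) (by rw [hμ.infOver_univ]; exact pos_iff_ne_zero.2 hb)
  rwa [univ_inter] at this

variable [T2Space 𝒳]

theorem lintegral_insEstimator_sq_le (hμ : IsGibbsFamily μ γ I)
    (hI : ContinuousOn I {x | I x < ∞}) (hα : IsParameter α)
    (hν : ∀ ε : ℝ, 0 < ε → ∀ j, IsProbabilityMeasure (gibbs γ I (ENNReal.ofReal ε / α j)))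
    (hA : infOver I A ≠ ⊤) (δ : ℝ) (hδ : 0 < δ) :
    ∃ c : ℝ≥0∞, c ≠ ⊤ ∧ ∀ᶠ ε in 𝓝[>] (0 : ℝ),
      ∫⁻ x, insEstimator I A α ε x ^ 2
          ∂(Measure.pi fun j => gibbs γ I (ENNReal.ofReal ε / α j)) ≤
        c * ENNReal.ofReal (Real.exp (-(V α * (infOver I A).toReal - δ) / ε)) := by
  have hIm : Measurable I := hμ.ldp.isRateFunction.measurable
  set a := (infOver I A).toReal with ha
  set L := V α * a with hL
  have hV : 0 ≤ V α := zero_le_one.trans (one_le_V hα)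
  have hL0 : 0 ≤ L := mul_nonneg hV ENNReal.toReal_nonneg
  have hK : (0 : ℝ) < K := by exact_mod_cast Nat.pos_of_ne_zero (NeZero.ne K)
  -- The error δ is shared equally: ηL ≤ δ/2 pays for the power κ = 1 - η, and the K factors e^{d/ε}
  -- with Kd = δ/2 pay for the normalizing constants. The 1 in L + 1 covers L = 0.
  set η := min (1 / 2) (δ / (2 * (L + 1))) with hη
  have hη0 : 0 < η := lt_min (by norm_num) (by positivity)
  have hη1 : η ≤ 1 / 2 := min_le_left _ _
  have hηL : η * L ≤ δ / 2 := by
    have h1 : η ≤ δ / (2 * (L + 1)) := min_le_right _ _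
    rw [le_div_iff₀ (by positivity)] at h1
    nlinarith
  set d := δ / (2 * K) with hd
  have hd0 : 0 < d := by positivity
  set κ := 1 - η with hκ
  have hκ0 : 0 < κ := by linarith
  have hκ1 : κ ≤ 1 := by linarith
  have hγ : γ {x | I x ≤ ENNReal.ofReal d} ≠ 0 :=
    hμ.measure_sublevel_ne_zero hI (by simpa using hd0)
  set g := γ {x | I x ≤ ENNReal.ofReal d} with hg
  set Z : Fin K → ℝ≥0∞ := fun j => partitionFunction γ I (ENNReal.ofReal 1 / α j) with hZ
  have hZtop : ∀ j, Z j ≠ ⊤ := fun j => (partitionFunction_ne (hν 1 one_pos j)).2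
  set N : ℝ≥0∞ := (Fintype.card (Equiv.Perm (Fin K)) : ℝ≥0∞) ^ 2 with hN
  have hNtop : N ≠ ⊤ := ENNReal.pow_ne_top (ENNReal.natCast_ne_top _)
  refine ⟨N ^ κ * ∏ j, (Z j * g⁻¹), ?_, ?_⟩
  · exact ENNReal.mul_ne_top (ENNReal.rpow_ne_top_of_nonneg hκ0.le hNtop)
      (ENNReal.prod_ne_top fun j _ => ENNReal.mul_ne_top (hZtop j) (ENNReal.inv_ne_top.2 hγ))
  have hev : ∀ᶠ ε in 𝓝[>] (0 : ℝ), ε ≤ η :=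
    (eventually_le_nhds hη0).filter_mono nhdsWithin_le_nhds
  filter_upwards [self_mem_nhdsWithin, hev] with ε (hε : 0 < ε) hεη
  have hprob := hν ε hε
  set w : Fin K → 𝒳 → ℝ≥0∞ := fun j y => expNeg (α j * I y / ENNReal.ofReal ε) ^ (-κ) with hw
  have hwm : ∀ j, Measurable (w j) := fun j =>
    (measurable_expNeg.comp ((hIm.const_mul _).div_const _)).pow_const _
  have hfactor : ∀ j, ∫⁻ y, w j y ∂(gibbs γ I (ENNReal.ofReal ε / α j)) ≤
      Z j * g⁻¹ * ENNReal.ofReal (Real.exp (d / ε)) := by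
    intro j
    refine (lintegral_rpow_neg_gibbs_le hIm hε hεη (α j) (δ := ENNReal.ofReal d)).trans ?_
    have hle : ENNReal.ofReal (Real.exp (-d / ε)) ≤
        expNeg (α j * ENNReal.ofReal d / ENNReal.ofReal ε) := by
      rw [← expNeg_ofReal_div hd0.le hε]
      refine expNeg_antitone (ENNReal.div_le_div_right (mul_le_of_le_one_left' ?_) _)
      exact_mod_cast hα.le_one j
    have hinv : (ENNReal.ofReal (Real.exp (-d / ε)) * g)⁻¹ =
        g⁻¹ * ENNReal.ofReal (Real.exp (d / ε)) := by
      rw [ENNReal.mul_inv (Or.inl (by simpa using Real.exp_pos _)) (Or.inl ENNReal.ofReal_ne_top),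
        ← ENNReal.ofReal_inv_of_pos (Real.exp_pos _), ← Real.exp_neg, mul_comm, neg_div, neg_neg]
    rw [mul_assoc, ← hinv]
    gcongr
  calc ∫⁻ x, insEstimator I A α ε x ^ 2
          ∂(Measure.pi fun j => gibbs γ I (ENNReal.ofReal ε / α j))
      ≤ ∫⁻ x, (N * expNeg (ENNReal.ofReal (V α) * infOver I A / ENNReal.ofReal ε)) ^ κ *
          ∏ j, w j (x j) ∂(Measure.pi fun j => gibbs γ I (ENNReal.ofReal ε / α j)) :=
        lintegral_mono fun x => insEstimator_sq_le hα hA hε hκ0 hκ1 x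
    _ = (N * expNeg (ENNReal.ofReal (V α) * infOver I A / ENNReal.ofReal ε)) ^ κ *
          ∏ j, ∫⁻ y, w j y ∂(gibbs γ I (ENNReal.ofReal ε / α j)) := by
        have hm : Measurable fun x : Fin K → 𝒳 => ∏ j, w j (x j) :=
          Finset.measurable_prod _ fun j _ => (hwm j).comp (measurable_pi_apply j)
        rw [lintegral_const_mul _ hm, lintegral_pi_prod _ hwm]
    _ ≤ (N ^ κ * ENNReal.ofReal (Real.exp (-(κ * L) / ε))) *
          ∏ j, (Z j * g⁻¹ * ENNReal.ofReal (Real.exp (d / ε))) := by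
        refine mul_le_mul' (le_of_eq ?_) (Finset.prod_le_prod' fun j _ => hfactor j)
        rw [ENNReal.mul_rpow_of_nonneg _ _ hκ0.le, ← ENNReal.ofReal_toReal hA, ← ha,
          ← ENNReal.ofReal_mul hV, expNeg_ofReal_div hL0 hε,
          ENNReal.ofReal_rpow_of_pos (Real.exp_pos _), ← Real.exp_mul]
        congr 3; ring
    _ = N ^ κ * (∏ j, Z j * g⁻¹) * ENNReal.ofReal (Real.exp (-(κ * L) / ε + K * (d / ε))) := by
        rw [Finset.prod_mul_distrib (g := fun _ => ENNReal.ofReal (Real.exp (d / ε))),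
          Finset.prod_const, Finset.card_univ, Fintype.card_fin,
          Real.exp_add, Real.exp_nat_mul, ENNReal.ofReal_mul (Real.exp_pos _).le,
          ENNReal.ofReal_pow (Real.exp_pos _).le]
        generalize ∏ j, Z j * g⁻¹ = p
        ring
    _ ≤ _ := by
        gcongr
        have : -(κ * L) / ε + K * (d / ε) = -(L - (η * L + δ / 2)) / ε := by
          rw [hκ, hd]; field_simp; ring
        rw [this]
        gcongr
        linarith

theorem le_lintegral_insEstimator_sq (hμ : IsGibbsFamily μ γ I)
    (hI : ContinuousOn I {x | I x < ∞}) (hα : IsParameter α)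
    (hν : ∀ ε : ℝ, 0 < ε → ∀ j, IsProbabilityMeasure (gibbs γ I (ENNReal.ofReal ε / α j)))
    (hA : infOver I A ≠ ⊤) (hAm : MeasurableSet A)
    (hAI : (Subtype.val ⁻¹' A : Set {x : 𝒳 // I x < ∞}) ⊆
      closure (interior (Subtype.val ⁻¹' A : Set {x : 𝒳 // I x < ∞})))
    (δ : ℝ) (hδ : 0 < δ) :
    ∃ c : ℝ≥0∞, c ≠ 0 ∧ ∀ᶠ ε in 𝓝[>] (0 : ℝ),
      c * ENNReal.ofReal (Real.exp (-(V α * (infOver I A).toReal + δ) / ε)) ≤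
        ∫⁻ x, insEstimator I A α ε x ^ 2
          ∂(Measure.pi fun j => gibbs γ I (ENNReal.ofReal ε / α j)) := by
  classical
  have hIm : Measurable I := hμ.ldp.isRateFunction.measurable
  set a := (infOver I A).toReal with ha
  have ha0 : 0 ≤ a := ENNReal.toReal_nonneg
  have haA : infOver I A = ENNReal.ofReal a := (ENNReal.ofReal_toReal hA).symm
  set s : ℝ := ∑ j, (α j : ℝ) with hs
  have hs0 : 0 < s := by
    have := Finset.single_le_sum (f := fun j => (α j : ℝ)) (fun j _ => (α j).coe_nonneg)
      (Finset.mem_univ 0)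
    simp only [hα.1, NNReal.coe_one] at this
    linarith
  -- Allowing levels to exceed b by d costs s·d twice through the squared estimator and once through
  -- the probability of the box.
  set d := δ / (3 * s) with hd
  have hd0 : 0 < d := by positivity
  have hds : 3 * (s * d) = δ := by rw [hd]; field_simp
  obtain ⟨S, hS0, hSV⟩ := exists_zeroOne_le_V hα.2
  obtain ⟨τ, hτ, hτmin⟩ := exists_decayFunctional_eq α (zeroOne S)
  set b : Fin K → ℝ := fun j => a * zeroOne S j with hb
  have hb0 : ∀ j, 0 ≤ b j := fun j => mul_nonneg ha0 (zeroOne_mem S j).1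
  have hbsum : ∀ σ : Equiv.Perm (Fin K), ∑ j, (α j : ℝ) * b (σ j) =
      a * ∑ j, (α j : ℝ) * zeroOne S (σ j) := fun σ => by
    rw [Finset.mul_sum]; exact Finset.sum_congr rfl fun j _ => by simp only [hb]; ring
  set M := ∑ j, (α j : ℝ) * b (τ j) with hM
  have hM0 : 0 ≤ M := sum_mul_nonneg fun j => hb0 _
  set R := ∑ j, (α j : ℝ) * b j with hR
  have hR0 : 0 ≤ R := sum_mul_nonneg hb0
  have hMmin : ∀ σ : Equiv.Perm (Fin K), M ≤ ∑ j, (α j : ℝ) * b (σ j) := fun σ => by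
    rw [hM, hbsum, hbsum]; exact mul_le_mul_of_nonneg_left (hτmin σ) ha0
  have hRM : 2 * R - M ≤ V α * a := by
    have h1 := hbsum 1
    simp only [Equiv.Perm.coe_one, id_eq] at h1
    rw [hR, hM, hbsum, h1]
    have := mul_le_mul_of_nonneg_left hSV ha0
    rw [hτ] at this
    linarith
  set B : Fin K → Set 𝒳 := fun j =>
    (if j ∈ S then A else univ) ∩ {x | I x ≤ ENNReal.ofReal (b j + d)} with hB
  have hBm : ∀ j, MeasurableSet (B j) := fun j => by
    refine MeasurableSet.inter ?_ (hIm measurableSet_Iic)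
    split_ifs
    exacts [hAm, MeasurableSet.univ]
  have hBle : ∀ j, ∀ x ∈ B j, I x ≤ ENNReal.ofReal (b j + d) := fun j x hx => hx.2
  have hBge : ∀ j, ∀ x ∈ B j, ENNReal.ofReal (b j) ≤ I x := fun j x hx => by
    by_cases hj : j ∈ S
    · have hxA : x ∈ A := by simpa [hj] using hx.1
      simp only [hb, zeroOne, if_pos hj, mul_one, ← haA]
      exact iInf₂_le x hxA
    · simp [hb, zeroOne, hj]
  have hBγ : ∀ j, γ (B j) ≠ 0 := fun j => by
    by_cases hj : j ∈ S
    · simp only [hB, if_pos hj]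
      refine hμ.measure_inter_le_ne_zero hI hAI ?_
      rw [haA]
      exact (ENNReal.ofReal_lt_ofReal_iff_of_nonneg ha0).2 (by simp [hb, zeroOne, hj, hd0])
    · simp only [hB, if_neg hj, univ_inter]
      refine hμ.measure_sublevel_ne_zero hI ?_
      simpa [hb, zeroOne, hj] using hd0
  set Z : Fin K → ℝ≥0∞ := fun j => partitionFunction γ I (ENNReal.ofReal 1 / α j) with hZ
  have hZtop : ∀ j, Z j ≠ ⊤ := fun j => (partitionFunction_ne (hν 1 one_pos j)).2
  set N : ℝ≥0∞ := (Fintype.card (Equiv.Perm (Fin K)) : ℝ≥0∞) with hN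
  have hN0 : N ≠ 0 := by simp [hN]
  have hNtop : N ≠ ⊤ := ENNReal.natCast_ne_top _
  refine ⟨N⁻¹ ^ 2 * ∏ j, ((Z j)⁻¹ * γ (B (τ j))), ?_, ?_⟩
  · refine mul_ne_zero (pow_ne_zero _ (ENNReal.inv_ne_zero.2 hNtop)) ?_
    exact Finset.prod_ne_zero_iff.2 fun j _ => mul_ne_zero (ENNReal.inv_ne_zero.2 (hZtop j)) (hBγ _)
  have hev : ∀ᶠ ε in 𝓝[>] (0 : ℝ), ε ≤ 1 :=
    (eventually_le_nhds one_pos).filter_mono nhdsWithin_le_nhds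
  filter_upwards [self_mem_nhdsWithin, hev] with ε (hε : 0 < ε) hε1
  have hprob := hν ε hε
  set ν : Fin K → Measure 𝒳 := fun j => gibbs γ I (ENNReal.ofReal ε / α j) with hνdef
  -- Coordinate j sits near level b (τ j), so the box has exponent M, the least possible. The
  -- permutation τ⁻¹ restores the order b, with numerator exponent R and its first point in A
  -- because 0 ∈ S. The total is 2(R - M) + M = 2R - M.
  set Q : Set (Fin K → 𝒳) := univ.pi fun j => B (τ j) with hQ
  have hQm : MeasurableSet Q := MeasurableSet.univ_pi fun j => hBm _
  set r : ℝ := Real.exp (-(R + s * d - M) / ε) with hr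
  have hest : ∀ x ∈ Q, N⁻¹ * ENNReal.ofReal r ≤ insEstimator I A α ε x := by
    intro x hx
    have hxB : ∀ j, x (τ.symm j) ∈ B j := fun j => by
      simpa using (mem_univ_pi.1 hx) (τ.symm j)
    have hxA : x (τ.symm 0) ∈ A := by
      have := (hxB 0).1
      simpa [hS0] using this
    have h1 : ENNReal.ofReal (Real.exp (-(R + s * d) / ε)) ≤
        expWeight I α ε (fun j => x (τ.symm j)) := by
      have hsum : R + s * d = ∑ j, (α j : ℝ) * (b j + d) := by
        simp only [mul_add, Finset.sum_add_distrib, ← Finset.sum_mul, hR, hs]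
      rw [← expNeg_ofReal_div (by positivity) hε, hsum,
        ← sum_coe_mul_ofReal _ _ fun j => add_nonneg (hb0 j) hd0.le]
      refine expNeg_antitone (ENNReal.div_le_div_right (Finset.sum_le_sum fun j _ => ?_) _)
      gcongr
      exact hBle j _ (hxB j)
    have h2 : ∀ σ : Equiv.Perm (Fin K), expWeight I α ε (fun j => x (σ j)) ≤
        ENNReal.ofReal (Real.exp (-M / ε)) := by
      intro σ
      rw [← expNeg_ofReal_div hM0 hε]
      refine expNeg_antitone (ENNReal.div_le_div_right ?_ _)
      calc ENNReal.ofReal M ≤ ENNReal.ofReal (∑ j, (α j : ℝ) * b (τ (σ j))) :=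
            ENNReal.ofReal_le_ofReal (hMmin (τ * σ))
        _ = ∑ j, (α j : ℝ≥0∞) * ENNReal.ofReal (b (τ (σ j))) :=
            (sum_coe_mul_ofReal _ _ fun j => hb0 _).symm
        _ ≤ _ := by
            refine Finset.sum_le_sum fun j _ => ?_
            gcongr
            exact hBge _ _ (mem_univ_pi.1 hx (σ j))
    refine le_of_eq_of_le ?_ (le_insEstimator (σ := τ.symm) hxA h1 h2)
    rw [div_eq_mul_inv, ENNReal.mul_inv (Or.inl hN0) (Or.inl hNtop),
      ← ENNReal.ofReal_inv_of_pos (Real.exp_pos _), ← Real.exp_neg, mul_left_comm,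
      ← ENNReal.ofReal_mul (Real.exp_pos _).le, ← Real.exp_add, hr]
    congr 3; ring
  have hmeas : (∏ j, ((Z j)⁻¹ * γ (B (τ j)))) * ENNReal.ofReal (Real.exp (-(M + s * d) / ε)) ≤
      Measure.pi ν Q := by
    rw [hQ, Measure.pi_pi]
    have hsum : M + s * d = ∑ j, (α j : ℝ) * (b (τ j) + d) := by
      simp only [mul_add, Finset.sum_add_distrib, ← Finset.sum_mul, hM, hs]
    rw [← expNeg_ofReal_div (by positivity) hε, hsum,
      ← sum_coe_mul_ofReal _ _ fun j => add_nonneg (hb0 (τ j)) hd0.le,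
      ENNReal.div_eq_inv_mul, Finset.mul_sum, expNeg_sum, ← Finset.prod_mul_distrib]
    refine Finset.prod_le_prod' fun j _ => ?_
    rw [← ENNReal.div_eq_inv_mul (b := ENNReal.ofReal ε)]
    exact le_gibbs_apply hε hε1 (α j) (hBm _) (hBle _)
  calc _ ≤ (N⁻¹ * ENNReal.ofReal r) ^ 2 * ((∏ j, ((Z j)⁻¹ * γ (B (τ j)))) *
        ENNReal.ofReal (Real.exp (-(M + s * d) / ε))) := by
        have hexp : ENNReal.ofReal (Real.exp (-(V α * a + δ) / ε)) ≤
            ENNReal.ofReal r ^ 2 * ENNReal.ofReal (Real.exp (-(M + s * d) / ε)) := by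
          rw [← ENNReal.ofReal_pow (Real.exp_pos _).le, ← ENNReal.ofReal_mul (by positivity),
            ← Real.exp_nat_mul, ← Real.exp_add]
          refine ENNReal.ofReal_le_ofReal (Real.exp_le_exp.2 ?_)
          have : ((2 : ℕ) : ℝ) * (-(R + s * d - M) / ε) + -(M + s * d) / ε =
              -((2 * R - M) + 3 * (s * d)) / ε := by push_cast; ring
          rw [this, hds]
          gcongr
        refine (mul_le_mul_right hexp _).trans (le_of_eq ?_)
        ring
    _ ≤ (N⁻¹ * ENNReal.ofReal r) ^ 2 * Measure.pi ν Q := by gcongr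
    _ = ∫⁻ x, Q.indicator (fun _ => (N⁻¹ * ENNReal.ofReal r) ^ 2) x ∂(Measure.pi ν) :=
        (lintegral_indicator_const hQm _).symm
    _ ≤ _ := by
        refine lintegral_mono fun x => ?_
        by_cases hx : x ∈ Q
        · simpa [hx] using pow_le_pow_left' (hest x hx) 2
        · simp [hx]

end SecondMoment

end INS

theorem theorem2 {𝒳 : Type*} [TopologicalSpace 𝒳] [PolishSpace 𝒳] [MeasurableSpace 𝒳]
    [BorelSpace 𝒳] (μ : ℝ → Measure 𝒳) (γ : Measure 𝒳) (I : 𝒳 → ℝ≥0∞)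
    (hμ : INS.IsGibbsFamily μ γ I)
    (hI : ContinuousOn I {x | I x < ∞})
    (A : Set 𝒳) (hA : A = closure (interior A))
    (hAI : (Subtype.val ⁻¹' A : Set {x : 𝒳 // I x < ∞}) =
      closure (interior (Subtype.val ⁻¹' A : Set {x : 𝒳 // I x < ∞})))
    (K : ℕ) [NeZero K] :
    (∀ α : Fin K → ℝ≥0, INS.IsParameter α →
      ∀ (Ω : ℝ → Type*) [∀ ε, MeasurableSpace (Ω ε)] (P : ∀ ε, Measure (Ω ε))
        [∀ ε, IsProbabilityMeasure (P ε)] (X : ∀ ε, Fin K → Ω ε → 𝒳),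
        (∀ ε, 0 < ε → iIndepFun (X ε) (P ε)) →
        (∀ ε, 0 < ε → ∀ j,
          HasLaw (X ε j) (INS.gibbs γ I (ENNReal.ofReal ε / (α j : ℝ≥0∞))) (P ε)) →
        Tendsto
          (fun ε : ℝ => -((ε : EReal) * ENNReal.log
            (∫⁻ ω, (INS.insEstimator I A α ε (fun j => X ε j ω)) ^ 2 ∂(P ε))))
          (𝓝[>] (0 : ℝ))
          (𝓝 ((INS.V α : EReal) * (INS.infOver I A : EReal)))) ∧
    INS.IsParameter (INS.alphaStar K) ∧
    INS.V (INS.alphaStar K) = 2 - (1 / 2 : ℝ) ^ (K - 1) ∧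
    ∀ α : Fin K → ℝ≥0, INS.IsParameter α → INS.V α ≤ INS.V (INS.alphaStar K) := by
  refine ⟨fun α hα Ω _ P _ X hind hX => ?_, INS.isParameter_alphaStar K, INS.V_alphaStar K,
    fun α hα => (INS.V_le_of_isParameter hα).trans_eq (INS.V_alphaStar K).symm⟩
  have hAm : MeasurableSet A := by rw [hA]; exact isClosed_closure.measurableSet
  have hIm : Measurable I := hμ.ldp.isRateFunction.measurable
  -- If I(A) = ∞ the estimator vanishes identically, and V(α) > 0 makes the limit ∞ as well.
  rcases eq_or_ne (INS.infOver I A) ⊤ with htop | htop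
  · rw [htop, EReal.coe_ennreal_top,
      EReal.coe_mul_top_of_pos (zero_lt_one.trans_le (INS.one_le_V hα))]
    refine tendsto_const_nhds.congr' ?_
    filter_upwards [self_mem_nhdsWithin] with ε hε
    simp [INS.insEstimator_eq_zero hα htop, EReal.coe_mul_bot_of_pos hε]
  have hν : ∀ ε : ℝ, 0 < ε → ∀ j,
      IsProbabilityMeasure (INS.gibbs γ I (ENNReal.ofReal ε / α j)) := fun ε hε j =>
    (hX ε hε j).isProbabilityMeasure_iff.1 inferInstance
  have hlim : ((INS.V α : EReal) * (INS.infOver I A : EReal)) =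
      ((INS.V α * (INS.infOver I A).toReal : ℝ) : EReal) := by
    rw [EReal.coe_mul]
    conv_lhs => rw [← ENNReal.ofReal_toReal htop]
    rw [EReal.coe_ennreal_ofReal, max_eq_left ENNReal.toReal_nonneg]
  rw [hlim]
  refine (INS.tendsto_neg_mul_log
    (INS.lintegral_insEstimator_sq_le hμ hI hα hν htop)
    (INS.le_lintegral_insEstimator_sq hμ hI hα hν htop hAm hAI.subset)).congr' ?_
  filter_upwards [self_mem_nhdsWithin] with ε (hε : 0 < ε)
  have haem : ∀ j, AEMeasurable (X ε j) (P ε) := fun j => (hX ε hε j).aemeasurable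
  -- Independence turns the expectation into an integral against the product of Gibbs measures,
  -- whatever the underlying probability space.
  have hmap : (P ε).map (fun ω j => X ε j ω) =
      Measure.pi fun j => INS.gibbs γ I (ENNReal.ofReal ε / α j) := by
    rw [(hind ε hε).map_fun_eq_pi_map haem]
    congr 1
    exact funext fun j => (hX ε hε j).map_eq
  rw [← hmap, lintegral_map' ((INS.measurable_insEstimator hIm hAm).pow_const 2).aemeasurable
    (aemeasurable_pi_lambda _ haem)]
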